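/- Let $\Omega\subset\mathbb R^d$ be nonempty, closed and convex, and let $P_\Omega$ denote the Euclidean projection onto $\Omega$. Let $U:\Omega\to\mathbb R^d$ be continuous and paramonotone on $\Omega$, that is, for all $a,b\in\Omega$ one has $\langle U(a)-U(b),a-b\rangle\ge 0$, with equality if and only if $U(a)=U(b)$. Assume that the solution set $$S=\{x_\star\in\Omega:\ \langle U(x_\star),a-x_\star\rangle\ge 0\ \text{ for all } a\in\Omega\}$$ of the variational inequality of $U$ on $\Omega$ is nonempty. Let $u>0$, $h>2\sqrt u$, $0<s<\tfrac12$, $\tfrac12<q\le 1$, $t_0\ge 0$ and $x_0,x_1\in\Omega$, and put $$\alpha_0(t)=\frac1{(t+1)^q},\qquad \alpha_1(t)=h+\frac1{(t+1)^s},\qquad \delta(t)=u,\qquad \lambda(t)=0 .$$ Let $x:[t_0,\infty)\to\mathbb R^d$ be a strong global solution of $$x''(t)+\alpha_1(t)x'(t)=\delta(t)\,[y(t)-x(t)],\qquad x(t_0)=x_0,\qquad x'(t_0)=\tfrac14\alpha_1(t_0)(x_1-x_0),$$ where, with $z(t)=x(t)+\lambda(t)x'(t)$, $$y(t)=P_\Omega\Bigl(z(t)-\frac{\alpha_0(t)}{\max\{1,\|U(z(t))\|\}}\,U(z(t))\Bigr);$$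 here, strong global solution means that $x$ is continuously differentiable on $[t_0,\infty)$ (one-sidedly at $t_0$), that $x$ and $x'$ are absolutely continuous on each interval $[a,b]$ with $b>a>t_0$, that the equation holds for almost every $t\ge t_0$, and that the two initial conditions hold. (If $U$ is extended to $\mathbb R^d$ by arbitrary values outside $\Omega$, the statement holds for every such extension; in particular it covers all solutions with values in $\Omega$.) Then there is $x_\star\in S$ such that $\lim_{t\to\infty}x(t)=x_\star$. -/

import Mathlib

open Set Filter Topology MeasureTheory

section VariationalInequality

variable {E : Type*} [NormedAddCommGroup E] [InnerProductSpace ℝ E]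

/-- The operator `U` is monotone on `Ω`. -/
def MonotoneOperatorOn (Ω : Set E) (U : E → E) : Prop :=
  ∀ a ∈ Ω, ∀ b ∈ Ω, 0 ≤ inner ℝ (U a - U b) (a - b)

/-- The operator `U` is paramonotone on `Ω`. -/
def ParamonotoneOperatorOn (Ω : Set E) (U : E → E) : Prop :=
  MonotoneOperatorOn Ω U ∧
    ∀ a ∈ Ω, ∀ b ∈ Ω, inner ℝ (U a - U b) (a - b) = 0 ↔ U a = U b

/-- The solution set of the variational inequality of `U` on `Ω`. -/
def viSolutions (Ω : Set E) (U : E → E) : Set E :=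
  {p | p ∈ Ω ∧ ∀ a ∈ Ω, 0 ≤ inner ℝ (U p) (a - p)}

/-- `p` is a point of `Ω` nearest to `z`. -/
def IsNearestPoint (Ω : Set E) (z p : E) : Prop :=
  p ∈ Ω ∧ ∀ w ∈ Ω, ‖z - p‖ ≤ ‖z - w‖

/-- The metric projection onto `Ω`: the point of `Ω` nearest to `z`. For `Ω` nonempty, closed and
convex in a complete space this point exists and is unique, see `metricProj_eq_iff`. -/
noncomputable def metricProj (Ω : Set E) (z : E) : E :=
  Classical.epsilon (IsNearestPoint Ω z)

theorem isNearestPoint_metricProj [CompleteSpace E] {Ω : Set E} (hne : Ω.Nonempty)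
    (hcl : IsClosed Ω) (hcv : Convex ℝ Ω) (z : E) :
    IsNearestPoint Ω z (metricProj Ω z) := by
  refine Classical.epsilon_spec (p := IsNearestPoint Ω z) ?_
  obtain ⟨p, hp, h⟩ := exists_norm_eq_iInf_of_complete_convex hne hcl.isComplete hcv z
  refine ⟨p, hp, fun w hw => ?_⟩
  rw [h]
  exact ciInf_le (f := fun w : Ω => ‖z - w‖)
    ⟨0, by rintro _ ⟨w, rfl⟩; exact norm_nonneg _⟩ ⟨w, hw⟩

theorem isNearestPoint_unique {Ω : Set E} (hcv : Convex ℝ Ω) {z p p' : E}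
    (hp : IsNearestPoint Ω z p) (hp' : IsNearestPoint Ω z p') : p = p' := by
  have hm := hp.2 _ (hcv hp.1 hp'.1 (by norm_num : (0 : ℝ) ≤ 1 / 2)
    (by norm_num : (0 : ℝ) ≤ 1 / 2) (by norm_num))
  have he : ‖z - p‖ = ‖z - p'‖ := le_antisymm (hp.2 _ hp'.1) (hp'.2 _ hp.1)
  have hpar := parallelogram_law_with_norm ℝ (z - p) (z - p')
  have h1 : (z - p) + (z - p') = (2 : ℝ) • (z - ((1 / 2 : ℝ) • p + (1 / 2 : ℝ) • p')) := by
    module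
  have h2 : (z - p) - (z - p') = p' - p := by abel
  rw [h1, h2, norm_smul, Real.norm_of_nonneg (by norm_num : (0 : ℝ) ≤ 2), ← he] at hpar
  have h0 : ‖p' - p‖ = 0 := by
    nlinarith [norm_nonneg (p' - p), norm_nonneg (z - p), mul_self_le_mul_self (norm_nonneg _) hm]
  exact (sub_eq_zero.1 (norm_eq_zero.1 h0)).symm

theorem metricProj_eq_iff [CompleteSpace E] {Ω : Set E} (hne : Ω.Nonempty)
    (hcl : IsClosed Ω) (hcv : Convex ℝ Ω) (z p : E) :
    metricProj Ω z = p ↔ IsNearestPoint Ω z p :=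
  ⟨fun h => h ▸ isNearestPoint_metricProj hne hcl hcv z,
    fun h => isNearestPoint_unique hcv (isNearestPoint_metricProj hne hcl hcv z) h⟩

end VariationalInequality

section DynamicalSystem

variable {E : Type*} [NormedAddCommGroup E] [InnerProductSpace ℝ E]

/-- One projection step of size `α` from the point `z`:
`P_Ω (z - α / max {1, ‖U z‖} • U z)`. -/
noncomputable def projStep (Ω : Set E) (U : E → E) (α : ℝ) (z : E) : E :=
  metricProj Ω (z - (α / max 1 ‖U z‖) • U z)

/-- `f` is absolutely continuous on each interval `[a, b]` with `b > a > t₀`. -/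
def LocallyACOnIoi (f : ℝ → E) (t₀ : ℝ) : Prop :=
  ∀ a b : ℝ, t₀ < a → a < b → AbsolutelyContinuousOnInterval f a b

/-- `x` is a strong global solution on `[t₀, ∞)` of
`x'' + α₁ x' = δ (y - x)`, `x(t₀) = x₀`, `x'(t₀) = (1/4) α₁(t₀) (x₁ - x₀)`, where
`y(t) = P_Ω (z - α₀(t) / max {1, ‖U z‖} • U z)` with `z = x(t) + λ(t) x'(t)`.
Here `v` is the derivative `x'` (one-sided at `t₀`); it is continuous on `[t₀, ∞)`, and the second
derivative `x'' = v'` is required to exist and to satisfy the equation almost everywhere. -/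
def IsStrongGlobalSolution (Ω : Set E) (U : E → E) (α₀ α₁ δ lam : ℝ → ℝ) (t₀ : ℝ) (x₀ x₁ : E)
    (x : ℝ → E) : Prop :=
  ∃ v : ℝ → E,
    (∀ t, t₀ ≤ t → HasDerivWithinAt x (v t) (Ici t₀) t) ∧
    ContinuousOn v (Ici t₀) ∧
    LocallyACOnIoi x t₀ ∧
    LocallyACOnIoi v t₀ ∧
    (∀ᵐ t : ℝ, t₀ ≤ t → ∃ acc : E, HasDerivAt v acc t ∧
      acc + α₁ t • v t = δ t • (projStep Ω U (α₀ t) (x t + lam t • v t) - x t)) ∧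
    x t₀ = x₀ ∧
    v t₀ = (1 / 4 * α₁ t₀) • (x₁ - x₀)

end DynamicalSystem

/-! The proof is a Lyapunov argument in continuous time, closed as in Opial's lemma.

Viability: since `h > 2√u` the equation is overdamped, so with forcing in `Ω` the trajectory cannot
leave `Ω` (`mem_of_isClosed_convex`). This matters because monotonicity is available only on `Ω`.

Energy: the forcing satisfies `‖y - x‖ ≤ α₀`, and `α₀ ^ 2` is integrable because `q > 1/2`. Hence
the velocity tends to zero (`tendsto_vel`). For each solution `p`, a Lyapunov function close to `h /
2 * ‖x - p‖ ^ 2` decreases at rate at least `u * g`, where `g = α₀ / max 1 ‖U x‖ * ⟪U x, x - p⟫ ≥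
0`. So `‖x - p‖` converges (`exists_tendsto_norm_sub`).

Conclusion: `α₀` is not integrable because `q ≤ 1`, so `⟪U x, x - p⟫` becomes arbitrarily small at
arbitrarily late times. By compactness some limit point `z` has `⟪U z, z - p⟫ ≤ 0`, and
paramonotonicity makes `z` a solution. Then `‖x - z‖` converges, and it tends to zero along a
subsequence, so `x` tends to `z`. -/

section AbsoluteContinuity

/-! ### Monotonicity from almost everywhere derivatives. -/

variable {X : Type*} [PseudoMetricSpace X]

theorem absolutelyContinuousOnInterval_of_dist_le {Y Z : Type*} [PseudoMetricSpace Y]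
    [PseudoMetricSpace Z] {f : ℝ → X} {g : ℝ → Y} {k : ℝ → Z} {a b C D : ℝ}
    (hg : AbsolutelyContinuousOnInterval g a b) (hk : AbsolutelyContinuousOnInterval k a b)
    (h : ∀ r ∈ uIcc a b, ∀ t ∈ uIcc a b,
      dist (f r) (f t) ≤ C * dist (g r) (g t) + D * dist (k r) (k t)) :
    AbsolutelyContinuousOnInterval f a b := by
  have hlim := (Tendsto.const_mul C hg).add (Tendsto.const_mul D hk)
  simp only [mul_zero, add_zero] at hlim
  refine squeeze_zero' (Eventually.of_forall fun t => Finset.sum_nonneg fun i _ => dist_nonneg)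
    ?_ hlim
  filter_upwards [mem_inf_of_right (mem_principal_self _)] with I hI
  rw [Finset.mul_sum, Finset.mul_sum, ← Finset.sum_add_distrib]
  exact Finset.sum_le_sum fun i hi => h _ (hI.1 i hi).1 _ (hI.1 i hi).2

/-- Integrate the derivative over `[c, b]` and let `c` decrease to `a`. Continuity covers the left
endpoint, near which absolute continuity is not assumed. -/
theorem le_of_ae_hasDerivAt_nonneg {f : ℝ → ℝ} {a b : ℝ} (hab : a ≤ b)
    (hc : ContinuousOn f (Icc a b))
    (hac : ∀ c ∈ Ioo a b, AbsolutelyContinuousOnInterval f c b)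
    (hd : ∀ᵐ t : ℝ, t ∈ Ioo a b → ∃ f', HasDerivAt f f' t ∧ 0 ≤ f') : f a ≤ f b := by
  rcases hab.eq_or_lt with rfl | hab
  · exact le_rfl
  have key : ∀ c ∈ Ioo a b, f c ≤ f b := by
    intro c hcm
    have h0 : 0 ≤ ∫ t in c..b, deriv f t := by
      refine intervalIntegral.integral_nonneg_of_ae_restrict hcm.2.le ?_
      refine (ae_restrict_iff' measurableSet_Icc).2 ?_
      filter_upwards [hd, Measure.ae_ne volume b] with t ht htb hm
      obtain ⟨f', h1, h2⟩ := ht ⟨hcm.1.trans_le hm.1, lt_of_le_of_ne hm.2 htb⟩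
      rw [Pi.zero_apply, h1.deriv]
      exact h2
    rw [(hac c hcm).integral_deriv_eq_sub] at h0
    linarith
  have hlim : Tendsto f (𝓝[>] a) (𝓝 (f a)) :=
    ((hc a (left_mem_Icc.2 hab.le)).mono_of_mem_nhdsWithin (Icc_mem_nhdsGT hab))
  exact le_of_tendsto hlim (by filter_upwards [Ioo_mem_nhdsGT hab] with c hc using key c hc)

theorem monotoneOn_of_ae_hasDerivAt_nonneg {f : ℝ → ℝ} {t₀ : ℝ}
    (hc : ContinuousOn f (Ici t₀)) (hac : LocallyACOnIoi f t₀)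
    (hd : ∀ᵐ t : ℝ, t₀ < t → ∃ f', HasDerivAt f f' t ∧ 0 ≤ f') : MonotoneOn f (Ici t₀) := by
  intro a ha b hb hab
  refine le_of_ae_hasDerivAt_nonneg hab (hc.mono fun t ht => le_trans ha ht.1)
    (fun c hc => hac c b (lt_of_le_of_lt ha hc.1) hc.2) ?_
  filter_upwards [hd] with t ht hm using ht (lt_of_le_of_lt ha hm.1)

theorem antitoneOn_of_ae_hasDerivAt_nonpos {f : ℝ → ℝ} {t₀ : ℝ}
    (hc : ContinuousOn f (Ici t₀)) (hac : LocallyACOnIoi f t₀)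
    (hd : ∀ᵐ t : ℝ, t₀ < t → ∃ f', HasDerivAt f f' t ∧ f' ≤ 0) : AntitoneOn f (Ici t₀) := by
  have := monotoneOn_of_ae_hasDerivAt_nonneg (f := fun t => -f t) hc.neg
    (fun a b h1 h2 => (hac a b h1 h2).fun_neg) (by
      filter_upwards [hd] with t ht hm
      obtain ⟨f', h1, h2⟩ := ht hm
      exact ⟨-f', h1.neg, by linarith⟩)
  intro a ha b hb hab
  have := this ha hb hab
  simp only [neg_le_neg_iff] at this
  exact this

theorem locallyACOnIoi_of_contDiffOn {E : Type*} [NormedAddCommGroup E] [NormedSpace ℝ E]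
    {f : ℝ → E} {t₀ : ℝ}
    (hf : ContDiffOn ℝ 1 f (Ioi t₀)) : LocallyACOnIoi f t₀ := fun a b ha hab =>
  ContDiffOn.absolutelyContinuousOnInterval (hf.mono fun t ht => by
    rw [uIcc_of_le hab.le] at ht
    exact lt_of_lt_of_le ha ht.1)

namespace LocallyACOnIoi

variable {E : Type*} [NormedAddCommGroup E]

theorem mono {f : ℝ → E} {t₀ t₁ : ℝ} (hf : LocallyACOnIoi f t₀) (h : t₀ ≤ t₁) :
    LocallyACOnIoi f t₁ := fun a b ha hab => hf a b (lt_of_le_of_lt h ha) hab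

theorem add {f g : ℝ → E} {t₀ : ℝ} (hf : LocallyACOnIoi f t₀) (hg : LocallyACOnIoi g t₀) :
    LocallyACOnIoi (fun t => f t + g t) t₀ := fun a b ha hab =>
  (hf a b ha hab).fun_add (hg a b ha hab)

theorem mul {f g : ℝ → ℝ} {t₀ : ℝ} (hf : LocallyACOnIoi f t₀) (hg : LocallyACOnIoi g t₀) :
    LocallyACOnIoi (fun t => f t * g t) t₀ := fun a b ha hab =>
  (hf a b ha hab).fun_mul (hg a b ha hab)

theorem const_mul {f : ℝ → ℝ} {t₀ : ℝ} (hf : LocallyACOnIoi f t₀) (c : ℝ) :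
    LocallyACOnIoi (fun t => c * f t) t₀ := fun a b ha hab => (hf a b ha hab).const_mul c

theorem sub_const {f : ℝ → E} {t₀ : ℝ} (hf : LocallyACOnIoi f t₀) (c : E) :
    LocallyACOnIoi (fun t => f t - c) t₀ := fun a b ha hab =>
  absolutelyContinuousOnInterval_of_dist_le (C := 1) (D := 0) (hf a b ha hab) (hf a b ha hab)
    fun r _ t _ => by simp

theorem clm_apply [NormedSpace ℝ E] {f : ℝ → E} {t₀ : ℝ} (hf : LocallyACOnIoi f t₀) (l : StrongDual ℝ E) :
    LocallyACOnIoi (fun t => l (f t)) t₀ := fun a b ha hab =>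
  absolutelyContinuousOnInterval_of_dist_le (C := ‖l‖) (D := 0) (hf a b ha hab) (hf a b ha hab)
    fun r _ t _ => by
      simpa [dist_eq_norm, ← map_sub] using l.le_opNorm (f r - f t)

theorem inner [InnerProductSpace ℝ E] {f g : ℝ → E} {t₀ : ℝ} (hf : LocallyACOnIoi f t₀) (hg : LocallyACOnIoi g t₀) :
    LocallyACOnIoi (fun t => inner ℝ (f t) (g t)) t₀ := fun a b ha hab => by
  obtain ⟨C, hC⟩ := (hf a b ha hab).exists_bound
  obtain ⟨D, hD⟩ := (hg a b ha hab).exists_bound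
  refine absolutelyContinuousOnInterval_of_dist_le (C := D) (D := C) (hf a b ha hab)
    (hg a b ha hab) fun r hr t ht => ?_
  rw [dist_eq_norm, dist_eq_norm, dist_eq_norm]
  have h1 : Inner.inner ℝ (f r) (g r) - Inner.inner ℝ (f t) (g t) =
      Inner.inner ℝ (f r - f t) (g r) + Inner.inner ℝ (f t) (g r - g t) := by
    simp only [inner_sub_left, inner_sub_right]; ring
  rw [h1]
  refine (norm_add_le _ _).trans (add_le_add ?_ ?_)
  · refine (norm_inner_le_norm _ _).trans ?_
    rw [mul_comm]
    exact mul_le_mul_of_nonneg_right (hD r hr) (norm_nonneg _)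
  · exact (norm_inner_le_norm _ _).trans (mul_le_mul_of_nonneg_right (hC t ht) (norm_nonneg _))

end LocallyACOnIoi

/-- A function bounded below cannot decrease at the nonintegrable rate `c / (t + 1)`. -/
theorem not_ae_hasDerivAt_le_neg_div {f : ℝ → ℝ} {t₀ T m c : ℝ} (ht₀ : 0 ≤ t₀) (hT : t₀ ≤ T)
    (hc : ContinuousOn f (Ici t₀)) (hac : LocallyACOnIoi f t₀) (hm : ∀ t, T ≤ t → m ≤ f t)
    (hcpos : 0 < c)
    (hd : ∀ᵐ t : ℝ, T < t → ∃ f', HasDerivAt f f' t ∧ f' ≤ -(c / (t + 1))) : False := by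
  have hcd : ∀ t, -1 < t → ContDiffAt ℝ 1 (fun t : ℝ => Real.log (t + 1)) t := fun t ht =>
    (contDiffAt_id.add contDiffAt_const).log (by simp only [id]; linarith)
  -- The assumed rate makes `f + c * log (t + 1)` nonincreasing, whereas a lower bound on `f` makes
  -- it tend to infinity.
  have hanti : AntitoneOn (fun t => f t + c * Real.log (t + 1)) (Ici T) := by
    refine antitoneOn_of_ae_hasDerivAt_nonpos ?_ ?_ ?_
    · refine (hc.mono (Ici_subset_Ici.2 hT)).add (continuousOn_const.mul fun t ht => ?_)
      exact (hcd t (by linarith [mem_Ici.1 ht])).continuousAt.continuousWithinAt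
    · refine (hac.mono hT).add (LocallyACOnIoi.const_mul (locallyACOnIoi_of_contDiffOn ?_) c)
      exact fun t ht => (hcd t (by linarith [mem_Ioi.1 ht])).contDiffWithinAt
    · filter_upwards [hd] with t ht hTt
      obtain ⟨f', h1, h2⟩ := ht hTt
      have hl : HasDerivAt (fun t : ℝ => Real.log (t + 1)) (1 / (t + 1)) t :=
        ((hasDerivAt_id t).add_const 1).log (by simp only [id]; linarith)
      exact ⟨_, h1.add (hl.const_mul c), by rw [mul_one_div]; linarith⟩
  have hlog : Tendsto (fun t : ℝ => c * Real.log (t + 1)) atTop atTop :=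
    (Real.tendsto_log_atTop.comp (tendsto_atTop_add_const_right _ 1 tendsto_id)).const_mul_atTop
      hcpos
  obtain ⟨t, ht, hTt⟩ := ((hlog.eventually_gt_atTop
    (f T + c * Real.log (T + 1) - m)).and (eventually_ge_atTop T)).exists
  have := hanti (mem_Ici.2 le_rfl) (mem_Ici.2 hTt) hTt
  have := hm t hTt
  simp only at *
  linarith

end AbsoluteContinuity

/-! ### Estimates for one projection step. -/

section Projection

variable {E : Type*} [NormedAddCommGroup E] [InnerProductSpace ℝ E]

theorem norm_stepSize_smul_le {α : ℝ} (hα : 0 ≤ α) (w : E) : ‖(α / max 1 ‖w‖) • w‖ ≤ α := by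
  have h1 : 0 < max 1 ‖w‖ := lt_max_of_lt_left one_pos
  rw [norm_smul, Real.norm_of_nonneg (by positivity), div_mul_eq_mul_div, div_le_iff₀ h1]
  exact mul_le_mul_of_nonneg_left (le_max_right _ _) hα

variable [CompleteSpace E]

theorem inner_sub_metricProj_le_zero {Ω : Set E} (hne : Ω.Nonempty) (hcl : IsClosed Ω)
    (hcv : Convex ℝ Ω) (z : E) {a : E} (ha : a ∈ Ω) :
    inner ℝ (z - metricProj Ω z) (a - metricProj Ω z) ≤ 0 := by
  obtain ⟨hm, hmin⟩ := isNearestPoint_metricProj hne hcl hcv z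
  refine (norm_eq_iInf_iff_real_inner_le_zero hcv hm).1 (le_antisymm ?_ ?_) a ha
  · have : Nonempty Ω := hne.to_subtype
    exact le_ciInf fun w => hmin w w.2
  · exact ciInf_le (f := fun w : Ω => ‖z - w‖)
      ⟨0, by rintro _ ⟨w, rfl⟩; exact norm_nonneg _⟩ ⟨_, hm⟩

theorem projStep_mem {Ω : Set E} (hne : Ω.Nonempty) (hcl : IsClosed Ω)
    (hcv : Convex ℝ Ω) (U : E → E) (α : ℝ) (z : E) : projStep Ω U α z ∈ Ω :=
  (isNearestPoint_metricProj hne hcl hcv _).1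

/-- The obtuse angle inequality tested at `z` itself gives `‖z - y‖ ^ 2 ≤ ⟪g, z - y⟫`, with `g` the
step of norm at most `α`. -/
theorem norm_projStep_sub_le {Ω : Set E} (hne : Ω.Nonempty) (hcl : IsClosed Ω)
    (hcv : Convex ℝ Ω) (U : E → E) {α : ℝ} (hα : 0 ≤ α) {z : E} (hz : z ∈ Ω) :
    ‖projStep Ω U α z - z‖ ≤ α := by
  have h := inner_sub_metricProj_le_zero hne hcl hcv (z - (α / max 1 ‖U z‖) • U z) hz
  change inner ℝ (z - (α / max 1 ‖U z‖) • U z - projStep Ω U α z) (z - projStep Ω U α z) ≤ 0 at h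
  set y := projStep Ω U α z
  set g := (α / max 1 ‖U z‖) • U z
  have hg : ‖g‖ ≤ α := norm_stepSize_smul_le hα _
  rw [show z - g - y = (z - y) - g by abel, inner_sub_left, real_inner_self_eq_norm_sq] at h
  have h2 := real_inner_le_norm g (z - y)
  rw [norm_sub_rev]
  by_contra! hlt
  have h3 := norm_nonneg (z - y)
  nlinarith

/-- Test the obtuse angle inequality at `p` and expand around `z`. The error `-⟪g, y - z⟫` is at
most `α ^ 2`, since both factors have norm at most `α`. -/
theorem inner_projStep_sub_le {Ω : Set E} (hne : Ω.Nonempty) (hcl : IsClosed Ω)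
    (hcv : Convex ℝ Ω) (U : E → E) {α : ℝ} (hα : 0 ≤ α) {z p : E} (hz : z ∈ Ω) (hp : p ∈ Ω) :
    inner ℝ (projStep Ω U α z - z) (z - p) ≤
      -(α / max 1 ‖U z‖ * inner ℝ (U z) (z - p)) + α ^ 2 := by
  have h := inner_sub_metricProj_le_zero hne hcl hcv (z - (α / max 1 ‖U z‖) • U z) hp
  have hy := norm_projStep_sub_le hne hcl hcv U hα hz
  change inner ℝ (z - (α / max 1 ‖U z‖) • U z - projStep Ω U α z) (p - projStep Ω U α z) ≤ 0 at h
  rw [← real_inner_smul_left]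
  set y := projStep Ω U α z
  have hg : ‖(α / max 1 ‖U z‖) • U z‖ ≤ α := norm_stepSize_smul_le hα _
  set g := (α / max 1 ‖U z‖) • U z
  have h3 : ‖g‖ * ‖y - z‖ ≤ α ^ 2 := by nlinarith [norm_nonneg g, norm_nonneg (y - z)]
  have h4 : ∀ a b : E, inner ℝ (-a - g) (-b - a) =
      inner ℝ a b + ‖a‖ ^ 2 + inner ℝ g b + inner ℝ g a := fun a b => by
    simp only [inner_sub_left, inner_sub_right, inner_neg_left, inner_neg_right,
      real_inner_self_eq_norm_sq]
    ring
  rw [show z - g - y = -(y - z) - g by abel, show p - y = -(z - p) - (y - z) by abel, h4] at h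
  have h5 := abs_le.1 (abs_real_inner_le_norm g (y - z))
  nlinarith [sq_nonneg ‖y - z‖, h5.1]

end Projection

/-! ### The damping coefficient and overdamping. -/

section Damping

/-- The damping coefficient `h + 1 / (t + 1) ^ s`. -/
noncomputable def damping (h s t : ℝ) : ℝ := h + 1 / (t + 1) ^ s

theorem hasDerivAt_add_one_rpow (r : ℝ) {t : ℝ} (ht : -1 < t) :
    HasDerivAt (fun t : ℝ => (t + 1) ^ r) (r * (t + 1) ^ (r - 1)) t := by
  have := (Real.hasDerivAt_rpow_const (x := t + 1) (p := r) (Or.inl (by linarith))).comp t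
    ((hasDerivAt_id t).add_const 1)
  simpa using! this

theorem contDiffAt_add_one_rpow (r : ℝ) {t : ℝ} (ht : -1 < t) :
    ContDiffAt ℝ 1 (fun t : ℝ => (t + 1) ^ r) t :=
  (contDiffAt_id.add contDiffAt_const).rpow_const_of_ne (by simp only [id]; linarith)

theorem hasDerivAt_damping (h s : ℝ) {t : ℝ} (ht : -1 < t) :
    HasDerivAt (damping h s) (-(s / (t + 1) * (1 / (t + 1) ^ s))) t := by
  have h1 := (hasDerivAt_add_one_rpow (-s) ht).const_add h
  have hpos : 0 < t + 1 := by linarith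
  have h2 : -s * (t + 1) ^ (-s - 1) = -(s / (t + 1) * (1 / (t + 1) ^ s)) := by
    rw [Real.rpow_sub_one hpos.ne', Real.rpow_neg hpos.le]
    field_simp
  rw [h2] at h1
  refine h1.congr_of_eventuallyEq ?_
  filter_upwards [eventually_gt_nhds ht] with r hr
  rw [damping, Real.rpow_neg (by linarith), one_div]

theorem contDiffAt_damping (h s : ℝ) {t : ℝ} (ht : -1 < t) : ContDiffAt ℝ 1 (damping h s) t :=
  contDiffAt_const.add (contDiffAt_const.div (contDiffAt_add_one_rpow s ht)
    (Real.rpow_pos_of_pos (by linarith) s).ne')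

theorem le_damping (h s : ℝ) {t : ℝ} (ht : 0 ≤ t) : h ≤ damping h s t := by
  have := Real.rpow_nonneg (by linarith : (0 : ℝ) ≤ t + 1) s
  rw [damping]
  have : 0 ≤ 1 / (t + 1) ^ s := by positivity
  linarith

theorem tendsto_one_div_add_one_rpow {s : ℝ} (hs : 0 < s) :
    Tendsto (fun t : ℝ => 1 / (t + 1) ^ s) atTop (𝓝 0) := by
  simp_rw [one_div]
  exact ((tendsto_rpow_atTop hs).comp
    (tendsto_atTop_add_const_right _ 1 tendsto_id)).inv_tendsto_atTop

theorem tendsto_damping (h : ℝ) {s : ℝ} (hs : 0 < s) :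
    Tendsto (damping h s) atTop (𝓝 h) := by
  have := (tendsto_one_div_add_one_rpow hs).const_add h
  rwa [add_zero] at this

theorem one_div_add_one_le {s t : ℝ} (hs : s ≤ 1) (ht : 0 ≤ t) :
    1 / (t + 1) ≤ 1 / (t + 1) ^ s := by
  refine one_div_le_one_div_of_le (Real.rpow_pos_of_pos (by linarith) s) ?_
  simpa using Real.rpow_le_rpow_of_exponent_le (by linarith : 1 ≤ t + 1) hs

/-- Overdamping: `b = damping / 2` satisfies the Riccati inequality `b' + b ^ 2 ≥ u`. -/
theorem le_damping_sq_add_deriv {h s u t : ℝ} (hu : 0 < u) (hh : 2 * Real.sqrt u < h)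
    (hs : s < 1 / 2) (ht : 0 ≤ t) :
    u ≤ (damping h s t / 2) ^ 2 + -(s / (t + 1) * (1 / (t + 1) ^ s)) / 2 := by
  have h1 := one_div_add_one_le (by linarith : s ≤ 1) ht
  have hε : 0 < 1 / (t + 1) ^ s := one_div_pos.2 (Real.rpow_pos_of_pos (by linarith) s)
  have h0 : 0 < 1 / (t + 1) := by positivity
  have hsq := Real.sq_sqrt hu.le
  have h3 : 0 ≤ Real.sqrt u := Real.sqrt_nonneg u
  rw [damping, div_eq_mul_one_div s]
  set ε := 1 / (t + 1) ^ s
  set θ := 1 / (t + 1)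
  -- Here `s < 1/2` enters: the loss `s * θ * ε / 2` is absorbed by the term `ε ^ 2 / 4` of the
  -- square.
  have h4 : s * θ ≤ ε / 2 := by nlinarith
  nlinarith

/-- `Real.exp ∘ B` serves as an integrating factor in the viability argument. -/
theorem exists_hasDerivAt_half_damping (h : ℝ) {s : ℝ} (hs : s < 1) :
    ∃ B : ℝ → ℝ, ∀ t, -1 < t → HasDerivAt B (damping h s t / 2) t ∧ ContDiffAt ℝ 1 B t := by
  refine ⟨fun t => (h * t + (t + 1) ^ (1 - s) / (1 - s)) / 2, fun t ht => ⟨?_, ?_⟩⟩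
  · have h1 := ((((hasDerivAt_id t).const_mul h).add
      ((hasDerivAt_add_one_rpow (1 - s) ht).div_const (1 - s)))).div_const 2
    convert! h1 using 1
    rw [damping, show 1 - s - 1 = -s by ring, Real.rpow_neg (by linarith)]
    have : 1 - s ≠ 0 := by linarith
    field_simp
  · exact ((contDiffAt_const.mul contDiffAt_id).add
      ((contDiffAt_add_one_rpow (1 - s) ht).div_const _)).div_const _

end Damping

/-! ### Viability: the trajectory stays in `Ω`. -/

section Trajectory

variable {E : Type*} [NormedAddCommGroup E] [InnerProductSpace ℝ E]

/-- `x` is a strong solution, with velocity `v`, of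
`x'' + (h + 1 / (t + 1) ^ s) x' = u (y - x)` on `[t₀, ∞)`. -/
structure IsDampedTrajectory (h s u t₀ : ℝ) (x v y : ℝ → E) : Prop where
  hasDerivWithinAt : ∀ t, t₀ ≤ t → HasDerivWithinAt x (v t) (Ici t₀) t
  continuousOn_vel : ContinuousOn v (Ici t₀)
  ac : LocallyACOnIoi x t₀
  ac_vel : LocallyACOnIoi v t₀
  ode : ∀ᵐ t : ℝ, t₀ ≤ t → HasDerivAt v (u • (y t - x t) - damping h s t • v t) t

namespace IsDampedTrajectory

variable {h s u t₀ : ℝ} {x v y : ℝ → E}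

theorem continuousOn (hx : IsDampedTrajectory h s u t₀ x v y) : ContinuousOn x (Ici t₀) :=
  fun t ht => (hx.hasDerivWithinAt t ht).continuousWithinAt

theorem hasDerivAt (hx : IsDampedTrajectory h s u t₀ x v y) {t : ℝ} (ht : t₀ < t) :
    HasDerivAt x (v t) t :=
  (hx.hasDerivWithinAt t ht.le).hasDerivAt (Ici_mem_nhds ht)

/-- An affine functional that is positive on the forcing term and initially stays positive. -/
theorem lt_apply (hx : IsDampedTrajectory h s u t₀ x v y) (ht₀ : 0 ≤ t₀) (hu : 0 < u)
    (hh : 2 * Real.sqrt u < h) (hs : s < 1 / 2) (l : StrongDual ℝ E) (c : ℝ)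
    (hy : ∀ t, t₀ ≤ t → c < l (y t)) (h0 : c < l (x t₀))
    (h1 : 0 < l (v t₀) + damping h s t₀ / 2 * (l (x t₀) - c)) {T : ℝ} (hT : t₀ ≤ T) :
    c < l (x T) := by
  obtain ⟨B, hB⟩ := exists_hasDerivAt_half_damping h (by linarith : s < 1)
  set w : ℝ → ℝ := fun t => l (x t) - c with hw
  -- This factors the second-order operator: `(exp B * w)' = exp B * p`, and `(exp B * p)' ≥ 0` as
  -- long as `w ≥ 0`, by the Riccati inequality.
  set p : ℝ → ℝ := fun t => l (v t) + damping h s t / 2 * w t with hp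
  have hwc : ContinuousOn w (Ici t₀) := (l.continuous.comp_continuousOn hx.continuousOn).sub
    continuousOn_const
  have hneg : ∀ {t}, t₀ ≤ t → -1 < t := fun h => by linarith
  have hdc : ContinuousOn (damping h s) (Ici t₀) := fun t ht =>
    (contDiffAt_damping h s (hneg ht)).continuousAt.continuousWithinAt
  have heC : ∀ {t}, -1 < t → ContDiffAt ℝ 1 (fun t => Real.exp (B t)) t := fun ht => (hB _ ht).2.exp
  have hec : ContinuousOn (fun t => Real.exp (B t)) (Ici t₀) := fun t ht =>
    (heC (hneg ht)).continuousAt.continuousWithinAt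
  have heac : LocallyACOnIoi (fun t => Real.exp (B t)) t₀ :=
    locallyACOnIoi_of_contDiffOn fun t ht => (heC (hneg (le_of_lt ht))).contDiffWithinAt
  have hdac : LocallyACOnIoi (fun t => 1 / 2 * damping h s t) t₀ :=
    (locallyACOnIoi_of_contDiffOn fun t ht =>
      (contDiffAt_damping h s (hneg (le_of_lt ht))).contDiffWithinAt).const_mul _
  have hwac : LocallyACOnIoi w t₀ := (hx.ac.clm_apply l).sub_const c
  have hpac : LocallyACOnIoi p t₀ := by
    have he : p = fun t => l (v t) + 1 / 2 * damping h s t * w t := by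
      funext t; simp only [hp]; ring
    rw [he]
    exact (hx.ac_vel.clm_apply l).add (hdac.mul hwac)
  have hpc : ContinuousOn p (Ici t₀) := (l.continuous.comp_continuousOn hx.continuousOn_vel).add
    ((hdc.div_const 2).mul hwc)
  have hwd : ∀ {t}, t₀ < t → HasDerivAt w (l (v t)) t := fun ht =>
    ((l.hasFDerivAt.comp_hasDerivAt _ (hx.hasDerivAt ht))).sub_const c
  by_contra! hcon
  -- the first time at which `w` is nonpositive
  set S : Set ℝ := {t | t ∈ Ici t₀ ∧ w t ∈ Iic 0} with hS
  have hScl : IsClosed S := hwc.preimage_isClosed_of_isClosed isClosed_Ici isClosed_Iic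
  have hSne : S.Nonempty := ⟨T, hT, by simp only [hw, mem_Iic]; linarith⟩
  have hSbd : BddBelow S := ⟨t₀, fun t ht => ht.1⟩
  obtain ⟨hτ₀, hτ⟩ : sInf S ∈ S := hScl.csInf_mem hSne hSbd
  set τ := sInf S
  have hbefore : ∀ t, t₀ ≤ t → t < τ → 0 < w t := fun t ht htτ => by
    by_contra! hle
    exact absurd (csInf_le hSbd (show t ∈ S from ⟨ht, hle⟩)) (not_le.2 htτ)
  have hppos : ∀ r, t₀ ≤ r → r ≤ τ → 0 < p r := by
    intro r hr hrτ
    have hmono : Real.exp (B t₀) * p t₀ ≤ Real.exp (B r) * p r := by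
      refine le_of_ae_hasDerivAt_nonneg (f := fun t => Real.exp (B t) * p t) hr
        ((hec.mul hpc).mono Icc_subset_Ici_self) (fun a ha => (heac.mul hpac) a r ha.1 ha.2) ?_
      filter_upwards [hx.ode] with t ht htm
      have hpd := (l.hasFDerivAt.comp_hasDerivAt _ (ht htm.1.le)).add
        (((hasDerivAt_damping h s (hneg htm.1.le)).div_const 2).mul (hwd htm.1))
      refine ⟨_, (hB t (hneg htm.1.le)).1.exp.mul hpd, ?_⟩
      have hwt := hbefore t htm.1.le (htm.2.trans_le hrτ)
      have hR := le_damping_sq_add_deriv hu hh hs (ht₀.trans htm.1.le)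
      have hyt := hy t htm.1.le
      have hlv : l (u • (y t - x t) - damping h s t • v t) =
          u * (l (y t) - c - w t) - damping h s t * l (v t) := by
        simp only [map_sub, map_smul, smul_eq_mul, hw]; ring
      rw [hlv]
      have h5 := mul_nonneg (sub_nonneg.2 hR) hwt.le
      have h6 := mul_nonneg hu.le (sub_nonneg.2 hyt.le)
      have hkey : 0 ≤ damping h s t / 2 * p t + (u * (l (y t) - c - w t) - damping h s t * l (v t) +
          (-(s / (t + 1) * (1 / (t + 1) ^ s)) / 2 * w t + damping h s t / 2 * l (v t))) := by
        simp only [hp]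
        nlinarith
      have := mul_nonneg (Real.exp_pos (B t)).le hkey
      linarith
    have := mul_pos (Real.exp_pos (B t₀)) h1
    exact (mul_pos_iff_of_pos_left (Real.exp_pos (B r))).1 (this.trans_le hmono)
  -- Positivity of `p` up to `τ` keeps `exp B * w` from decreasing, so `w τ > 0`, against the choice
  -- of `τ`.
  have hmono : Real.exp (B t₀) * w t₀ ≤ Real.exp (B τ) * w τ := by
    refine le_of_ae_hasDerivAt_nonneg (f := fun t => Real.exp (B t) * w t) hτ₀
      ((hec.mul hwc).mono Icc_subset_Ici_self) (fun a ha => (heac.mul hwac) a τ ha.1 ha.2) ?_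
    refine Eventually.of_forall fun t htm => ?_
    refine ⟨_, (hB t (hneg htm.1.le)).1.exp.mul (hwd htm.1), ?_⟩
    have := mul_pos (Real.exp_pos (B t)) (hppos t htm.1.le htm.2.le)
    simp only [hp] at this
    linarith
  have h3 : 0 < w t₀ := by simp only [hw]; linarith
  have h4 := (mul_pos (Real.exp_pos (B t₀)) h3).trans_le hmono
  have h5 := (mul_pos_iff_of_pos_left (Real.exp_pos (B τ))).1 h4
  exact absurd hτ (not_le.2 h5)

/-- A point outside `Ω` would be strictly separated from it by some `l`, while `lt_apply` keeps the
trajectory on the side of `Ω`. -/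
theorem mem_of_isClosed_convex (hx : IsDampedTrajectory h s u t₀ x v y) (ht₀ : 0 ≤ t₀)
    (hu : 0 < u) (hh : 2 * Real.sqrt u < h) (hs : s < 1 / 2) {Ω : Set E} (hcl : IsClosed Ω)
    (hcv : Convex ℝ Ω) (hy : ∀ t, t₀ ≤ t → y t ∈ Ω) (h0 : x t₀ ∈ Ω) {x₁ : E} (hx₁ : x₁ ∈ Ω)
    (hv : v t₀ = (1 / 4 * damping h s t₀) • (x₁ - x t₀)) {t : ℝ} (ht : t₀ ≤ t) : x t ∈ Ω := by
  by_contra hcon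
  obtain ⟨l, c, hlt, hgt⟩ := geometric_hahn_banach_point_closed hcv hcl hcon
  refine absurd (hx.lt_apply ht₀ hu hh hs l c (fun t ht => hgt _ (hy t ht)) (hgt _ h0) ?_ ht)
    (not_lt.2 hlt.le)
  have hd : 0 < damping h s t₀ :=
    (lt_of_le_of_lt (by positivity) hh).trans_le (le_damping h s ht₀)
  have e1 := hgt _ h0
  have e2 := hgt _ hx₁
  rw [hv]
  simp only [map_smul, map_sub, smul_eq_mul]
  -- The factor `1/4` in the initial velocity turns the required quantity into `damping / 4` times
  -- `(l x₁ - c) + (l x₀ - c)`.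
  nlinarith [mul_pos hd (sub_pos.2 e1), mul_pos hd (sub_pos.2 e2)]

end IsDampedTrajectory

end Trajectory

/-! ### Integrable errors and limits of monotone functions. -/

section Tail

/-- The tail integral of `1 / (t + 1) ^ (2 * q)`. -/
noncomputable def sqTail (q t : ℝ) : ℝ := (t + 1) ^ (1 - 2 * q) / (2 * q - 1)

theorem hasDerivAt_sqTail {q t : ℝ} (hq : 1 / 2 < q) (ht : -1 < t) :
    HasDerivAt (sqTail q) (-(1 / (t + 1) ^ q) ^ 2) t := by
  have hpos : 0 < t + 1 := by linarith
  have h1 := (hasDerivAt_add_one_rpow (1 - 2 * q) ht).div_const (2 * q - 1)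
  convert! h1 using 1
  rw [show 1 - 2 * q - 1 = -(q + q) by ring, Real.rpow_neg hpos.le, Real.rpow_add hpos]
  have h2 : 2 * q - 1 ≠ 0 := by linarith
  have h3 := (Real.rpow_pos_of_pos hpos q).ne'
  field_simp
  ring

theorem contDiffAt_sqTail {q t : ℝ} (ht : -1 < t) : ContDiffAt ℝ 1 (sqTail q) t :=
  (contDiffAt_add_one_rpow _ ht).div_const _

theorem sqTail_nonneg {q t : ℝ} (hq : 1 / 2 < q) (ht : 0 ≤ t) : 0 ≤ sqTail q t :=
  div_nonneg (Real.rpow_nonneg (by linarith) _) (by linarith)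

theorem tendsto_sqTail {q : ℝ} (hq : 1 / 2 < q) : Tendsto (sqTail q) atTop (𝓝 0) := by
  have h1 := (tendsto_one_div_add_one_rpow (s := 2 * q - 1) (by linarith)).div_const (2 * q - 1)
  rw [zero_div] at h1
  refine h1.congr' ?_
  filter_upwards [eventually_ge_atTop 0] with t ht
  rw [sqTail, show 1 - 2 * q = -(2 * q - 1) by ring, Real.rpow_neg (by linarith), one_div]

theorem exists_tendsto_of_antitoneOn {f : ℝ → ℝ} {T m : ℝ} (hf : AntitoneOn f (Ici T))
    (hm : ∀ t, T ≤ t → m ≤ f t) : ∃ L, Tendsto f atTop (𝓝 L) := by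
  have ha : Antitone fun t => f (max t T) := fun a b hab =>
    hf (mem_Ici.2 (le_max_right _ _)) (mem_Ici.2 (le_max_right _ _)) (max_le_max_right _ hab)
  refine ⟨_, (tendsto_atTop_ciInf ha ⟨m, ?_⟩).congr' ?_⟩
  · rintro _ ⟨t, rfl⟩
    exact hm _ (le_max_right _ _)
  · filter_upwards [eventually_ge_atTop T] with t ht
    simp only [max_eq_left ht]

end Tail

/-! ### Decay of the velocity and the Lyapunov function. -/

section Energy

variable {E : Type*} [NormedAddCommGroup E] [InnerProductSpace ℝ E]

/-- Kinetic energy corrected by the tail of the squared forcing. -/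
noncomputable def kineticEnergy (h u q : ℝ) (v : ℝ → E) (t : ℝ) : ℝ :=
  1 / 2 * inner ℝ (v t) (v t) + u ^ 2 / (2 * h) * sqTail q t

namespace IsDampedTrajectory

variable {h s u t₀ q : ℝ} {x v y : ℝ → E}

theorem locallyACOnIoi_sqTail (ht₀ : 0 ≤ t₀) (c : ℝ) :
    LocallyACOnIoi (fun t => c * sqTail q t) t₀ :=
  (locallyACOnIoi_of_contDiffOn fun t ht =>
    (contDiffAt_sqTail (by linarith [mem_Ioi.1 ht])).contDiffWithinAt).const_mul _

theorem continuousOn_sqTail (ht₀ : 0 ≤ t₀) : ContinuousOn (sqTail q) (Ici t₀) := fun t ht =>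
  (contDiffAt_sqTail (by linarith [mem_Ici.1 ht])).continuousAt.continuousWithinAt

theorem ac_kineticEnergy (hx : IsDampedTrajectory h s u t₀ x v y) (ht₀ : 0 ≤ t₀) :
    LocallyACOnIoi (kineticEnergy h u q v) t₀ :=
  ((hx.ac_vel.inner hx.ac_vel).const_mul _).add (locallyACOnIoi_sqTail ht₀ _)

theorem continuousOn_kineticEnergy (hx : IsDampedTrajectory h s u t₀ x v y) (ht₀ : 0 ≤ t₀) :
    ContinuousOn (kineticEnergy h u q v) (Ici t₀) :=
  (continuousOn_const.mul (hx.continuousOn_vel.inner hx.continuousOn_vel)).add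
    (continuousOn_const.mul (continuousOn_sqTail ht₀))

theorem kineticEnergy_nonneg (ht₀ : 0 ≤ t₀) (hh : 0 < h) (hq : 1 / 2 < q) {t : ℝ} (ht : t₀ ≤ t) :
    0 ≤ kineticEnergy h u q v t := by
  have h1 := sqTail_nonneg hq (ht₀.trans ht)
  have h2 : 0 ≤ inner ℝ (v t) (v t) := real_inner_self_nonneg
  rw [kineticEnergy]
  positivity

theorem ae_hasDerivAt_kineticEnergy (hx : IsDampedTrajectory h s u t₀ x v y) (ht₀ : 0 ≤ t₀)
    (hu : 0 < u) (hh : 0 < h) (hq : 1 / 2 < q)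
    (hyx : ∀ t, t₀ ≤ t → ‖y t - x t‖ ≤ 1 / (t + 1) ^ q) :
    ∀ᵐ t : ℝ, t₀ ≤ t → ∃ H', HasDerivAt (kineticEnergy h u q v) H' t ∧
      H' ≤ -(h / 2 * ‖v t‖ ^ 2) := by
  filter_upwards [hx.ode] with t ht htt
  have hv := ht htt
  have ht0 : 0 ≤ t := ht₀.trans htt
  refine ⟨_, ((hv.inner ℝ hv).const_mul _).add
    ((hasDerivAt_sqTail hq (by linarith)).const_mul _), ?_⟩
  have h0 : inner ℝ (v t) (u • (y t - x t) - damping h s t • v t) =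
      u * inner ℝ (v t) (y t - x t) - damping h s t * ‖v t‖ ^ 2 := by
    rw [inner_sub_right, real_inner_smul_right, real_inner_smul_right, real_inner_self_eq_norm_sq]
  rw [real_inner_comm (v t) (u • (y t - x t) - damping h s t • v t), h0]
  have h1 := real_inner_le_norm (v t) (y t - x t)
  have h2 := hyx t htt
  have hd := le_damping h s ht0
  set a := 1 / (t + 1) ^ q
  have h3 : inner ℝ (v t) (y t - x t) ≤ ‖v t‖ * a :=
    h1.trans (mul_le_mul_of_nonneg_left h2 (norm_nonneg _))
  -- Young's inequality: half of the damping absorbs the forcing, and the remaining square is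
  -- cancelled by the derivative of the tail.
  have h4 : u * (‖v t‖ * a) ≤ h / 2 * ‖v t‖ ^ 2 + u ^ 2 / (2 * h) * a ^ 2 := by
    have : h / 2 * ‖v t‖ ^ 2 + u ^ 2 / (2 * h) * a ^ 2 - u * (‖v t‖ * a) =
        (h * ‖v t‖ - u * a) ^ 2 / (2 * h) := by
      field_simp
      ring
    have h5 : 0 ≤ (h * ‖v t‖ - u * a) ^ 2 / (2 * h) := by positivity
    linarith
  have h6 := mul_le_mul_of_nonneg_right hd (sq_nonneg ‖v t‖)
  have h7 := mul_le_mul_of_nonneg_left h3 hu.le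
  linarith

theorem antitoneOn_kineticEnergy (hx : IsDampedTrajectory h s u t₀ x v y) (ht₀ : 0 ≤ t₀)
    (hu : 0 < u) (hh : 0 < h) (hq : 1 / 2 < q)
    (hyx : ∀ t, t₀ ≤ t → ‖y t - x t‖ ≤ 1 / (t + 1) ^ q) :
    AntitoneOn (kineticEnergy h u q v) (Ici t₀) := by
  refine antitoneOn_of_ae_hasDerivAt_nonpos (hx.continuousOn_kineticEnergy ht₀)
    (hx.ac_kineticEnergy ht₀) ?_
  filter_upwards [hx.ae_hasDerivAt_kineticEnergy ht₀ hu hh hq hyx] with t ht htt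
  obtain ⟨H', h1, h2⟩ := ht htt.le
  exact ⟨H', h1, h2.trans (neg_nonpos.2 (by positivity))⟩

/-- A positive limit `L` would keep `‖v‖ ^ 2` above `L` eventually, and the dissipation would then
drive the energy below zero. -/
theorem tendsto_kineticEnergy (hx : IsDampedTrajectory h s u t₀ x v y) (ht₀ : 0 ≤ t₀)
    (hu : 0 < u) (hh : 0 < h) (hq : 1 / 2 < q)
    (hyx : ∀ t, t₀ ≤ t → ‖y t - x t‖ ≤ 1 / (t + 1) ^ q) :
    Tendsto (kineticEnergy h u q v) atTop (𝓝 0) := by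
  obtain ⟨L, hL⟩ := exists_tendsto_of_antitoneOn (hx.antitoneOn_kineticEnergy ht₀ hu hh hq hyx)
    fun t ht => kineticEnergy_nonneg ht₀ hh hq ht
  have hL0 : 0 ≤ L := ge_of_tendsto hL (by
    filter_upwards [eventually_ge_atTop t₀] with t ht using kineticEnergy_nonneg ht₀ hh hq ht)
  rcases hL0.eq_or_lt with rfl | hLpos
  · exact hL
  exfalso
  have hlim := hL.sub ((tendsto_sqTail hq).const_mul (u ^ 2 / (2 * h)))
  rw [mul_zero, sub_zero] at hlim
  obtain ⟨T, hT⟩ := eventually_atTop.1 ((hlim.eventually_const_lt (half_lt_self hLpos)).and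
    (eventually_ge_atTop t₀))
  have hTt := (hT T le_rfl).2
  refine not_ae_hasDerivAt_le_neg_div ht₀ hTt (hx.continuousOn_kineticEnergy ht₀)
    (hx.ac_kineticEnergy ht₀) (m := 0)
    (fun t ht => kineticEnergy_nonneg (q := q) ht₀ hh hq (hTt.trans ht))
    (c := h * L / 2) (by positivity) ?_
  filter_upwards [hx.ae_hasDerivAt_kineticEnergy ht₀ hu hh hq hyx] with t ht hTt'
  obtain ⟨H', h1, h2⟩ := ht (hTt.trans hTt'.le)
  refine ⟨H', h1, h2.trans (neg_le_neg ?_)⟩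
  have h3 := (hT t hTt'.le).1
  rw [kineticEnergy, real_inner_self_eq_norm_sq] at h3
  -- The actual rate is constant; it is weakened to the form that `not_ae_hasDerivAt_le_neg_div`
  -- takes.
  have h4 : h * L / 2 / (t + 1) ≤ h * L / 2 :=
    div_le_self (by positivity) (by linarith)
  nlinarith

theorem tendsto_vel (hx : IsDampedTrajectory h s u t₀ x v y) (ht₀ : 0 ≤ t₀)
    (hu : 0 < u) (hh : 0 < h) (hq : 1 / 2 < q)
    (hyx : ∀ t, t₀ ≤ t → ‖y t - x t‖ ≤ 1 / (t + 1) ^ q) : Tendsto v atTop (𝓝 0) := by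
  have hlim := (((hx.tendsto_kineticEnergy ht₀ hu hh hq hyx).sub
    ((tendsto_sqTail hq).const_mul (u ^ 2 / (2 * h)))).const_mul 2).sqrt
  simp only [mul_zero, sub_zero, Real.sqrt_zero] at hlim
  refine tendsto_zero_iff_norm_tendsto_zero.2 (hlim.congr fun t => ?_)
  rw [kineticEnergy, real_inner_self_eq_norm_sq, add_sub_cancel_right, ← mul_assoc]
  norm_num

/-- The Lyapunov function of the trajectory relative to `p`. -/
noncomputable def lyapunov (h s u q : ℝ) (x v : ℝ → E) (p : E) (t : ℝ) : ℝ :=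
  inner ℝ (v t) (x t - p) + damping h s t * (1 / 2 * inner ℝ (x t - p) (x t - p)) +
    2 / h * kineticEnergy h u q v t + u * sqTail q t

theorem ac_lyapunov (hx : IsDampedTrajectory h s u t₀ x v y) (ht₀ : 0 ≤ t₀) (p : E) :
    LocallyACOnIoi (lyapunov h s u q x v p) t₀ := by
  have hxp := hx.ac.sub_const p
  have hd : LocallyACOnIoi (damping h s) t₀ := locallyACOnIoi_of_contDiffOn fun t ht =>
    (contDiffAt_damping h s (by linarith [mem_Ioi.1 ht])).contDiffWithinAt
  exact (((hx.ac_vel.inner hxp).add (hd.mul ((hxp.inner hxp).const_mul _))).add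
    ((hx.ac_kineticEnergy ht₀).const_mul _)).add (locallyACOnIoi_sqTail ht₀ _)

theorem continuousOn_lyapunov (hx : IsDampedTrajectory h s u t₀ x v y) (ht₀ : 0 ≤ t₀) (p : E) :
    ContinuousOn (lyapunov h s u q x v p) (Ici t₀) := by
  have hxp : ContinuousOn (fun t => x t - p) (Ici t₀) := hx.continuousOn.sub continuousOn_const
  have hd : ContinuousOn (damping h s) (Ici t₀) := fun t ht =>
    (contDiffAt_damping h s (by linarith [mem_Ici.1 ht])).continuousAt.continuousWithinAt
  exact (((hx.continuousOn_vel.inner hxp).add (hd.mul (continuousOn_const.mul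
    (hxp.inner hxp)))).add (continuousOn_const.mul (hx.continuousOn_kineticEnergy ht₀))).add
    (continuousOn_const.mul (continuousOn_sqTail ht₀))

/-- The Lyapunov function decreases at least at the rate `u * g` when the forcing satisfies
`⟪y - x, x - p⟫ ≤ -g + 1 / (t + 1) ^ (2 * q)`. -/
theorem ae_hasDerivAt_lyapunov (hx : IsDampedTrajectory h s u t₀ x v y) (ht₀ : 0 ≤ t₀)
    (hu : 0 < u) (hh : 0 < h) (hs : 0 ≤ s) (hq : 1 / 2 < q)
    (hyx : ∀ t, t₀ ≤ t → ‖y t - x t‖ ≤ 1 / (t + 1) ^ q) {p : E} {g : ℝ → ℝ}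
    (hg : ∀ t, t₀ ≤ t → inner ℝ (y t - x t) (x t - p) ≤ -g t + (1 / (t + 1) ^ q) ^ 2) :
    ∀ᵐ t : ℝ, t₀ < t → ∃ F', HasDerivAt (lyapunov h s u q x v p) F' t ∧ F' ≤ -(u * g t) := by
  filter_upwards [hx.ode, hx.ae_hasDerivAt_kineticEnergy ht₀ hu hh hq hyx] with t hv hH htt
  replace hv := hv htt.le
  obtain ⟨H', hH1, hH2⟩ := hH htt.le
  have ht0 : 0 ≤ t := ht₀.trans htt.le
  have hxd : HasDerivAt (fun t => x t - p) (v t) t := (hx.hasDerivAt htt).sub_const p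
  refine ⟨_, (((hv.inner ℝ hxd).add ((hasDerivAt_damping h s (by linarith)).mul
    ((hxd.inner ℝ hxd).const_mul _))).add (hH1.const_mul _)).add
    ((hasDerivAt_sqTail hq (by linarith)).const_mul _), ?_⟩
  have h1 : inner ℝ (u • (y t - x t) - damping h s t • v t) (x t - p) =
      u * inner ℝ (y t - x t) (x t - p) - damping h s t * inner ℝ (v t) (x t - p) := by
    rw [inner_sub_left, real_inner_smul_left, real_inner_smul_left]
  rw [h1, real_inner_comm (v t) (x t - p), real_inner_self_eq_norm_sq,
    real_inner_self_eq_norm_sq]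
  -- The weight `2 / h` is chosen so that the energy cancels the `‖v‖ ^ 2` coming from
  -- differentiating `⟪v, x - p⟫`.
  have h2 : 2 / h * H' ≤ -‖v t‖ ^ 2 := by
    have := mul_le_mul_of_nonneg_left hH2 (by positivity : 0 ≤ 2 / h)
    have e : 2 / h * -(h / 2 * ‖v t‖ ^ 2) = -‖v t‖ ^ 2 := by field_simp
    linarith
  have h3 : 0 ≤ s / (t + 1) * (1 / (t + 1) ^ s) * (1 / 2 * ‖x t - p‖ ^ 2) := by
    have := Real.rpow_nonneg (by linarith : 0 ≤ t + 1) s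
    positivity
  have h4 := mul_le_mul_of_nonneg_left (hg t htt.le) hu.le
  linarith

/-- Along the trajectory the distance to `p` is bounded, and it converges; moreover the decrease
rate `g` cannot dominate `c / (t + 1)`. -/
theorem exists_tendsto_norm_sub (hx : IsDampedTrajectory h s u t₀ x v y) (ht₀ : 0 ≤ t₀)
    (hu : 0 < u) (hh : 0 < h) (hs : 0 < s) (hq : 1 / 2 < q)
    (hyx : ∀ t, t₀ ≤ t → ‖y t - x t‖ ≤ 1 / (t + 1) ^ q) {p : E} {g : ℝ → ℝ}
    (hg : ∀ t, t₀ ≤ t → inner ℝ (y t - x t) (x t - p) ≤ -g t + (1 / (t + 1) ^ q) ^ 2)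
    (hg0 : ∀ t, t₀ ≤ t → 0 ≤ g t) :
    (∃ M, ∀ t, t₀ ≤ t → ‖x t - p‖ ≤ M) ∧ (∃ L, Tendsto (fun t => ‖x t - p‖) atTop (𝓝 L)) ∧
      ∀ c > 0, ∀ T, t₀ ≤ T → ∃ t, T ≤ t ∧ g t < c / (t + 1) := by
  have hF := hx.ae_hasDerivAt_lyapunov ht₀ hu hh hs.le hq hyx hg
  have hanti : AntitoneOn (lyapunov h s u q x v p) (Ici t₀) := by
    refine antitoneOn_of_ae_hasDerivAt_nonpos (hx.continuousOn_lyapunov ht₀ p)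
      (hx.ac_lyapunov ht₀ p) ?_
    filter_upwards [hF] with t ht htt
    obtain ⟨F', h1, h2⟩ := ht htt
    exact ⟨F', h1, h2.trans (neg_nonpos.2 (mul_nonneg hu.le (hg0 t htt.le)))⟩
  set φ : ℝ → ℝ := fun t => 1 / 2 * inner ℝ (x t - p) (x t - p) with hφ
  have hφ0 : ∀ t, 0 ≤ φ t := fun t => mul_nonneg (by norm_num) real_inner_self_nonneg
  have hφn : ∀ t, ‖x t - p‖ = Real.sqrt (2 * φ t) := fun t => by
    simp only [hφ]
    rw [real_inner_self_eq_norm_sq, ← mul_assoc]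
    norm_num
  set C := lyapunov h s u q x v p t₀
  obtain ⟨K, hK⟩ : ∃ K, ∀ t, t₀ ≤ t → φ t ≤ K := by
    -- The bound on the Lyapunov function gives `φ' + h * φ ≤ C`. The extra `1` makes `φ' < 0`
    -- strict wherever `φ` meets the barrier.
    refine ⟨max (φ t₀) (C / h + 1), fun t ht => ?_⟩
    refine image_le_of_deriv_right_lt_deriv_boundary (f := φ)
      (f' := fun t => inner ℝ (v t) (x t - p)) (a := t₀) (b := t)
      (B := fun _ => max (φ t₀) (C / h + 1)) (B' := fun _ => 0) ?_ ?_ (le_max_left _ _)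
      (fun _ => hasDerivAt_const _ _) ?_ ⟨ht, le_rfl⟩
    · have hxp : ContinuousOn (fun t => x t - p) (Ici t₀) := hx.continuousOn.sub continuousOn_const
      exact (continuousOn_const.mul (hxp.inner hxp)).mono Icc_subset_Ici_self
    · intro r hr
      have hxd : HasDerivWithinAt (fun t => x t - p) (v r) (Ici r) r :=
        ((hx.hasDerivWithinAt r hr.1).mono (Ici_subset_Ici.2 hr.1)).sub_const p
      convert! (hxd.inner ℝ hxd).const_mul (1 / 2 : ℝ) using 1
      rw [real_inner_comm (v r) (x r - p)]
      ring
    · intro r hr hbd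
      have hFr : lyapunov h s u q x v p r ≤ C := hanti (mem_Ici.2 le_rfl) hr.1 hr.1
      have h1 := kineticEnergy_nonneg (u := u) (v := v) ht₀ hh hq hr.1
      have h2 := sqTail_nonneg hq (ht₀.trans hr.1)
      have h3 := mul_le_mul_of_nonneg_right (le_damping h s (ht₀.trans hr.1)) (hφ0 r)
      have h4 : C / h + 1 ≤ φ r := hbd ▸ le_max_right _ _
      have h5 : C + h ≤ h * φ r := by
        have := mul_le_mul_of_nonneg_left h4 hh.le
        have e : h * (C / h + 1) = C + h := by field_simp
        linarith
      have h6 : 0 ≤ 2 / h * kineticEnergy h u q v r := by positivity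
      have h7 : 0 ≤ u * sqTail q r := by positivity
      have h8 : lyapunov h s u q x v p r = inner ℝ (v r) (x r - p) + damping h s r * φ r +
        2 / h * kineticEnergy h u q v r + u * sqTail q r := rfl
      linarith
  have hM : ∀ t, t₀ ≤ t → ‖x t - p‖ ≤ Real.sqrt (2 * K) := fun t ht => by
    rw [hφn]
    exact Real.sqrt_le_sqrt (mul_le_mul_of_nonneg_left (hK t ht) (by norm_num))
  have hvel := hx.tendsto_vel ht₀ hu hh hq hyx
  have hinner : Tendsto (fun t => inner ℝ (v t) (x t - p)) atTop (𝓝 0) := by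
    have h1 := hvel.norm.mul_const (Real.sqrt (2 * K))
    rw [norm_zero, zero_mul] at h1
    refine squeeze_zero_norm' ?_ h1
    filter_upwards [eventually_ge_atTop t₀] with t ht
    exact (norm_inner_le_norm _ _).trans (mul_le_mul_of_nonneg_left (hM t ht) (norm_nonneg _))
  obtain ⟨T₁, hT₁⟩ := eventually_atTop.1 ((hinner.eventually_const_lt
    (by norm_num : (-1 : ℝ) < 0)).and (eventually_ge_atTop t₀))
  have hbelow : ∀ t, T₁ ≤ t → -1 ≤ lyapunov h s u q x v p t := fun t ht => by
    obtain ⟨h0, htt⟩ := hT₁ t ht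
    have h1 := kineticEnergy_nonneg (u := u) (v := v) ht₀ hh hq htt
    have h2 := sqTail_nonneg hq (ht₀.trans htt)
    have h3 := mul_nonneg (hh.le.trans (le_damping h s (ht₀.trans htt))) (hφ0 t)
    have h6 : 0 ≤ 2 / h * kineticEnergy h u q v t := by positivity
    have h7 : 0 ≤ u * sqTail q t := by positivity
    have h8 : lyapunov h s u q x v p t = inner ℝ (v t) (x t - p) + damping h s t * φ t +
      2 / h * kineticEnergy h u q v t + u * sqTail q t := rfl
    linarith
  refine ⟨⟨_, hM⟩, ?_, ?_⟩
  · obtain ⟨L, hL⟩ := exists_tendsto_of_antitoneOn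
      (hanti.mono (Ici_subset_Ici.2 (hT₁ T₁ le_rfl).2)) hbelow
    -- Every term of the Lyapunov function except `damping * φ` tends to zero, and `damping` tends
    -- to `h > 0`, so `φ` converges.
    have hlim := (((hL.sub ((tendsto_sqTail hq).const_mul u)).sub
      ((hx.tendsto_kineticEnergy ht₀ hu hh hq hyx).const_mul (2 / h))).sub hinner).div
      (tendsto_damping h hs) hh.ne'
    refine ⟨_, ((hlim.const_mul 2).sqrt).congr' ?_⟩
    filter_upwards [eventually_ge_atTop t₀] with t ht
    have hd : damping h s t ≠ 0 := (hh.trans_le (le_damping h s (ht₀.trans ht))).ne'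
    rw [hφn]
    congr 2
    simp only [Pi.div_apply]
    rw [div_eq_iff hd]
    simp only [lyapunov, hφ]
    ring
  · intro c hc T hT
    by_contra! hcon
    refine not_ae_hasDerivAt_le_neg_div ht₀ (hT.trans (le_max_left T T₁))
      (hx.continuousOn_lyapunov (q := q) ht₀ p) (hx.ac_lyapunov ht₀ p)
      (fun t ht => hbelow t ((le_max_right _ _).trans ht)) (mul_pos hu hc) ?_
    filter_upwards [hF] with t ht htt
    have hTt : T ≤ t := (le_max_left _ _).trans htt.le
    obtain ⟨F', h1, h2⟩ := ht ((hT.trans (le_max_left _ _)).trans_lt htt)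
    refine ⟨F', h1, h2.trans (neg_le_neg ?_)⟩
    rw [mul_div_assoc]
    exact mul_le_mul_of_nonneg_left (hcon t hTt) hu.le

end IsDampedTrajectory

end Energy

/-! ### Paramonotonicity and the conclusion. -/

section VariationalInequality

variable {E : Type*} [NormedAddCommGroup E] [InnerProductSpace ℝ E]

/-- Monotonicity and the inequality at `p` force `⟪U z - U p, z - p⟫ = 0`, so `U z = U p` and `⟪U p,
z - p⟫ = 0`; the inequality at `p` then transfers to `z`. -/
theorem mem_viSolutions_of_paramonotone {Ω : Set E} {U : E → E}
    (hU : ParamonotoneOperatorOn Ω U) {p z : E} (hp : p ∈ viSolutions Ω U) (hz : z ∈ Ω)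
    (h : inner ℝ (U z) (z - p) ≤ 0) : z ∈ viSolutions Ω U := by
  have h1 := hU.1 z hz p hp.1
  have h2 := hp.2 z hz
  rw [inner_sub_left] at h1
  have h3 : U z = U p := (hU.2 z hz p hp.1).1 (by rw [inner_sub_left]; linarith)
  refine ⟨hz, fun a ha => ?_⟩
  have h4 := hp.2 a ha
  rw [h3] at h ⊢
  rw [show a - z = (a - p) - (z - p) by abel, inner_sub_right]
  linarith

end VariationalInequality

theorem mainTheorem5 (d : ℕ) (Ω : Set (EuclideanSpace ℝ (Fin d)))
    (U : EuclideanSpace ℝ (Fin d) → EuclideanSpace ℝ (Fin d))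
    (hΩne : Ω.Nonempty) (hΩcl : IsClosed Ω) (hΩcv : Convex ℝ Ω)
    (hsol : (viSolutions Ω U).Nonempty)
    (hUpara : ParamonotoneOperatorOn Ω U) (hUcont : ContinuousOn U Ω)
    (q h s u : ℝ) (hu : 0 < u) (hh : 2 * Real.sqrt u < h)
    (hs0 : 0 < s) (hs : s < 1 / 2) (hq0 : 1 / 2 < q) (hq : q ≤ 1)
    (t₀ : ℝ) (ht₀ : 0 ≤ t₀)
    (x₀ x₁ : EuclideanSpace ℝ (Fin d)) (hx₀ : x₀ ∈ Ω) (hx₁ : x₁ ∈ Ω)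
    (x : ℝ → EuclideanSpace ℝ (Fin d))
    (hx : IsStrongGlobalSolution Ω U
      (fun t => 1 / (t + 1) ^ q) (fun t => h + 1 / (t + 1) ^ s) (fun _ => u) (fun _ => 0)
      t₀ x₀ x₁ x) :
    ∃ p ∈ viSolutions Ω U, Tendsto x atTop (𝓝 p) := by
  obtain ⟨v, hxd, hvc, hxac, hvac, hode, hxt₀, hvt₀⟩ := hx
  have hpos : 0 < h := lt_of_le_of_lt (by positivity) hh
  set y : ℝ → EuclideanSpace ℝ (Fin d) := fun t => projStep Ω U (1 / (t + 1) ^ q) (x t) with hy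
  have htraj : IsDampedTrajectory h s u t₀ x v y := by
    refine ⟨hxd, hvc, hxac, hvac, ?_⟩
    filter_upwards [hode] with t ht htt
    obtain ⟨acc, h1, h2⟩ := ht htt
    simp only [zero_smul, add_zero] at h2
    rwa [eq_sub_of_add_eq h2] at h1
  have hyΩ : ∀ t, y t ∈ Ω := fun t => projStep_mem hΩne hΩcl hΩcv U _ _
  have hxΩ : ∀ t, t₀ ≤ t → x t ∈ Ω := fun t ht =>
    htraj.mem_of_isClosed_convex ht₀ hu hh hs hΩcl hΩcv (fun t _ => hyΩ t) (hxt₀ ▸ hx₀) hx₁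
      (by rw [hvt₀, hxt₀, damping]) ht
  have hα : ∀ t, t₀ ≤ t → 0 ≤ 1 / (t + 1) ^ q := fun t ht =>
    one_div_nonneg.2 (Real.rpow_nonneg (by linarith) q)
  have hyx : ∀ t, t₀ ≤ t → ‖y t - x t‖ ≤ 1 / (t + 1) ^ q := fun t ht =>
    norm_projStep_sub_le hΩne hΩcl hΩcv U (hα t ht) (hxΩ t ht)
  have hmain := fun (p : EuclideanSpace ℝ (Fin d)) (hp : p ∈ viSolutions Ω U) =>
    htraj.exists_tendsto_norm_sub ht₀ hu hpos hs0 hq0 hyx (p := p)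
      (g := fun t => 1 / (t + 1) ^ q / max 1 ‖U (x t)‖ * inner ℝ (U (x t)) (x t - p))
      (fun t ht => inner_projStep_sub_le hΩne hΩcl hΩcv U (hα t ht) (hxΩ t ht) hp.1)
      (fun t ht => by
        have h1 := hUpara.1 _ (hxΩ t ht) p hp.1
        have h2 := hp.2 _ (hxΩ t ht)
        rw [inner_sub_left] at h1
        have h3 := hα t ht
        have h4 : 0 ≤ inner ℝ (U (x t)) (x t - p) := by linarith
        positivity)
  obtain ⟨p, hp⟩ := hsol
  obtain ⟨⟨M, hM⟩, -, hinf⟩ := hmain p hp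
  set K : Set (EuclideanSpace ℝ (Fin d)) := Metric.closedBall p M ∩ Ω with hKdef
  have hKc : IsCompact K := (isCompact_closedBall p M).inter_right hΩcl
  have hxK : ∀ t, t₀ ≤ t → x t ∈ K := fun t ht =>
    ⟨mem_closedBall_iff_norm.2 (hM t ht), hxΩ t ht⟩
  obtain ⟨N, hN⟩ := hKc.exists_bound_of_continuousOn (hUcont.mono inter_subset_right)
  have hfreq : ∀ n : ℕ, ∃ t, t₀ + n ≤ t ∧ inner ℝ (U (x t)) (x t - p) < 1 / ((n : ℝ) + 1) := by
    intro n
    have hD : 0 < max 1 N := lt_max_of_lt_left one_pos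
    -- `N` bounds `‖U‖` on the compact set containing the trajectory, so dividing the constant by
    -- `max 1 N` compensates for the normalisation of the step.
    obtain ⟨t, ht, hlt⟩ := hinf (1 / ((n : ℝ) + 1) / max 1 N) (by positivity) (t₀ + n)
      (by linarith [n.cast_nonneg (α := ℝ)])
    have htt : t₀ ≤ t := by linarith [n.cast_nonneg (α := ℝ)]
    refine ⟨t, ht, ?_⟩
    by_contra! hcon
    have ht0 : 0 ≤ t := ht₀.trans htt
    have h1 : 1 / (t + 1) / max 1 N ≤ 1 / (t + 1) ^ q / max 1 ‖U (x t)‖ :=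
      div_le_div₀ (hα t htt) (one_div_add_one_le hq ht0) (lt_max_of_lt_left one_pos)
        (max_le_max_left _ (hN _ (hxK t htt)))
    have h2 := mul_le_mul h1 hcon (by positivity)
      (div_nonneg (hα t htt) (le_max_of_le_left zero_le_one))
    have h3 : 1 / (t + 1) / max 1 N * (1 / ((n : ℝ) + 1)) =
        1 / ((n : ℝ) + 1) / max 1 N / (t + 1) := by ring
    linarith
  choose τ hτ hτlt using hfreq
  have hτt₀ : ∀ n, t₀ ≤ τ n := fun n => by linarith [hτ n, n.cast_nonneg (α := ℝ)]
  have hτlim : Tendsto τ atTop atTop :=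
    tendsto_atTop_mono hτ (tendsto_atTop_add_const_left _ t₀ tendsto_natCast_atTop_atTop)
  obtain ⟨z, hzK, σ, hσ, hz⟩ := hKc.tendsto_subseq fun n => hxK (τ n) (hτt₀ n)
  have hUz : Tendsto (fun n => U (x (τ (σ n)))) atTop (𝓝 (U z)) :=
    (hUcont z hzK.2).tendsto.comp (tendsto_nhdsWithin_iff.2
      ⟨hz, Eventually.of_forall fun n => hxΩ _ (hτt₀ _)⟩)
  have hzsol : z ∈ viSolutions Ω U := by
    refine mem_viSolutions_of_paramonotone hUpara hp hzK.2 ?_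
    exact le_of_tendsto_of_tendsto' (hUz.inner (hz.sub_const p))
      (tendsto_one_div_add_atTop_nhds_zero_nat.comp hσ.tendsto_atTop) fun n => (hτlt (σ n)).le
  -- Convergence of the distance is now used with the limit point `z` as the reference solution.
  obtain ⟨-, ⟨L, hL⟩, -⟩ := hmain z hzsol
  have h0 : Tendsto (fun n => ‖x (τ (σ n)) - z‖) atTop (𝓝 0) :=
    tendsto_iff_norm_sub_tendsto_zero.1 hz
  have hL0 : L = 0 := tendsto_nhds_unique (hL.comp (hτlim.comp hσ.tendsto_atTop)) h0
  exact ⟨z, hzsol, tendsto_iff_norm_sub_tendsto_zero.2 (hL0 ▸ hL)⟩
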